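/- Let $\mathcal{A}=(L_1,\dots,L_{10})$ be an arrangement of $10$ pairwise distinct lines in the complex projective plane $\mathbb{CP}^2$. For two $10$-tuples $\mathcal{B}=(H_1,\dots,H_{10})$ and $\mathcal{B}'=(H_1',\dots,H_{10}')$ of lines, write $L(\mathcal{B})=L(\mathcal{B}')$ if $\dim\bigcap_{i\in S}H_i=\dim\bigcap_{i\in S}H_i'$ for every nonempty $S\subseteq\{1,\dots,10\}$ (with $\dim\emptyset=-1$). Let $$\mathcal{M}_{\mathcal{A}}=\{\mathcal{B}\in((\mathbb{CP}^2)^*)^{10} : L(\mathcal{B})=L(\mathcal{A})\}/PGL(3,\mathbb{C})$$ be the (ordered) moduli space of $\mathcal{A}$, with the quotient of the Zariski topology. If there is a point of $\mathbb{CP}^2$ of multiplicity at least $6$ in $\mathcal{A}$, i.e. lying on at least $6$ of the lines $L_1,\dots,L_{10}$, then $\mathcal{M}_{\mathcal{A}}$ is irreducible (in particular nonempty). -/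

import Mathlib

noncomputable section

namespace LineArrangement

open scoped LinearAlgebra.Projectivization MatrixGroups

/-- The complex projective plane `ℂℙ²`. -/
abbrev Plane : Type := ℙ ℂ (Fin 3 → ℂ)

/-- The dual plane `(ℂℙ²)^*`: a point of it is a line of `ℂℙ²`, given by a nonzero linear form
on `ℂ³` up to scalars. -/
abbrev DualPlane : Type := ℙ ℂ (Module.Dual ℂ (Fin 3 → ℂ))

/-- The two-dimensional linear subspace of `ℂ³` whose projectivization is the line `L`. -/
def lineSubmodule (L : DualPlane) : Submodule ℂ (Fin 3 → ℂ) := LinearMap.ker L.rep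

/-- The set of points of `ℂℙ²` lying on the line `L`. -/
def linePoints (L : DualPlane) : Set Plane := {p | p.rep ∈ lineSubmodule L}

/-- `((ℂℙ²)^*)ⁿ`, the space of ordered `n`-tuples of lines; it carries the Zariski topology. -/
def LineTuple (n : ℕ) : Type := Fin n → DualPlane

variable {n : ℕ}

/-- Homogeneous coordinates: `coords B (i, j)` is the coefficient of the `j`-th variable in the
chosen linear form defining the `i`-th line. -/
def coords (B : LineTuple n) (x : Fin n × Fin 3) : ℂ := (B x.1).rep (Pi.single x.2 1)

/-- `p` is homogeneous in each of the `n` groups of three variables separately. -/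
def IsMultihomogeneous (p : MvPolynomial (Fin n × Fin 3) ℂ) : Prop :=
  ∃ d : Fin n → ℕ,
    MvPolynomial.IsWeightedHomogeneous (fun x : Fin n × Fin 3 => (Pi.single x.1 1 : Fin n → ℕ)) p d

/-- The common zero locus in `((ℂℙ²)^*)ⁿ` of a set of multihomogeneous polynomials. -/
def zeroLocus (S : Set (MvPolynomial (Fin n × Fin 3) ℂ)) : Set (LineTuple n) :=
  {B | ∀ p ∈ S, MvPolynomial.eval (coords B) p = 0}

/-- Vanishing of a multihomogeneous polynomial does not depend on the choice of the linear forms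
defining the lines. -/
theorem eval_coords_eq_zero_iff {p : MvPolynomial (Fin n × Fin 3) ℂ} (hp : IsMultihomogeneous p)
    (B : LineTuple n) (f : Fin n → Module.Dual ℂ (Fin 3 → ℂ)) (hf : ∀ i, f i ≠ 0)
    (hB : ∀ i, B i = Projectivization.mk ℂ (f i) (hf i)) :
    MvPolynomial.eval (coords B) p = 0 ↔
      MvPolynomial.eval (fun x : Fin n × Fin 3 => f x.1 (Pi.single x.2 1)) p = 0 := by
  obtain ⟨d, hd⟩ := hp
  have h : ∀ i, ∃ a : ℂˣ, a • f i = (B i).rep := by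
    intro i
    rw [hB i]
    exact Projectivization.exists_smul_eq_mk_rep ℂ (f i) (hf i)
  choose a ha using h
  have key : MvPolynomial.eval (coords B) p = (∏ i, (a i : ℂ) ^ d i) *
      MvPolynomial.eval (fun x : Fin n × Fin 3 => f x.1 (Pi.single x.2 1)) p := by
    rw [MvPolynomial.eval_eq, MvPolynomial.eval_eq, Finset.mul_sum]
    refine Finset.sum_congr rfl fun m hm => ?_
    have hw := hd (MvPolynomial.mem_support_iff.mp hm)
    have hdi : ∀ i, d i = ∑ j : Fin 3, m (i, j) := by
      intro i
      rw [← hw, Finsupp.weight_apply, Finsupp.sum_fintype _ _ (by simp), Finset.sum_apply,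
        Fintype.sum_prod_type, Finset.sum_eq_single i]
      · simp
      · intro k _ hk
        simp [Ne.symm hk]
      · simp
    have hc : ∀ x, coords B x = (a x.1 : ℂ) * f x.1 (Pi.single x.2 1) := by
      intro x
      simp [coords, ← ha x.1, Units.smul_def]
    have hprod : ∏ x ∈ m.support, coords B x ^ m x = (∏ i, (a i : ℂ) ^ d i) *
        ∏ x ∈ m.support, f x.1 (Pi.single x.2 1) ^ m x := by
      have e1 : ∀ g : Fin n × Fin 3 → ℂ, ∏ x ∈ m.support, g x ^ m x = ∏ x, g x ^ m x := by
        intro g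
        exact Finset.prod_subset (Finset.subset_univ _) (by
          intro x _ hx
          simp [Finsupp.notMem_support_iff.mp hx])
      rw [e1, e1 (fun x => f x.1 (Pi.single x.2 1))]
      simp only [hc, mul_pow, Finset.prod_mul_distrib]
      congr 1
      rw [Fintype.prod_prod_type]
      refine Finset.prod_congr rfl fun i _ => ?_
      simp only [hdi i, Finset.prod_pow_eq_pow_sum]
    rw [hprod]
    ring
  have hne : (∏ i, (a i : ℂ) ^ d i) ≠ 0 :=
    Finset.prod_ne_zero_iff.mpr fun i _ => pow_ne_zero _ (a i).ne_zero
  rw [key, mul_eq_zero, or_iff_right hne]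

/-- The Zariski topology on `((ℂℙ²)^*)ⁿ`: the closed sets are the common zero loci of sets of
multihomogeneous polynomials. -/
instance zariskiTopology : TopologicalSpace (LineTuple n) :=
  TopologicalSpace.ofClosed
    {Z | ∃ S : Set (MvPolynomial (Fin n × Fin 3) ℂ),
      (∀ p ∈ S, IsMultihomogeneous p) ∧ Z = zeroLocus S}
    (by
      refine ⟨{1}, ?_, ?_⟩
      · rintro p rfl
        exact ⟨0, MvPolynomial.isWeightedHomogeneous_one _ _⟩
      · ext B
        simp [zeroLocus])
    (by
      intro A hA
      have hA' : ∀ Z ∈ A, ∃ S : Set (MvPolynomial (Fin n × Fin 3) ℂ),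
          (∀ p ∈ S, IsMultihomogeneous p) ∧ Z = zeroLocus S := fun Z h => hA h
      choose! S hS hZ using hA'
      refine ⟨⋃ Z ∈ A, S Z, ?_, ?_⟩
      · intro p hp
        simp only [Set.mem_iUnion] at hp
        obtain ⟨Z, hZA, hp⟩ := hp
        exact hS Z hZA p hp
      · ext B
        simp only [Set.mem_sInter, zeroLocus, Set.mem_ofPred_eq, Set.mem_iUnion]
        constructor
        · rintro h p ⟨Z, hZA, hp⟩
          have hB := h Z hZA
          rw [hZ Z hZA] at hB
          exact hB p hp
        · intro h Z hZA
          rw [hZ Z hZA]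
          exact fun p hp => h p ⟨Z, hZA, hp⟩)
    (by
      rintro _ ⟨S, hS, rfl⟩ _ ⟨T, hT, rfl⟩
      refine ⟨{r | ∃ p ∈ S, ∃ q ∈ T, r = p * q}, ?_, ?_⟩
      · rintro _ ⟨p, hp, q, hq, rfl⟩
        obtain ⟨d, hd⟩ := hS p hp
        obtain ⟨e, he⟩ := hT q hq
        exact ⟨d + e, hd.mul he⟩
      · ext B
        constructor
        · rintro (h | h) _ ⟨p, hp, q, hq, rfl⟩
          · rw [map_mul, h p hp, zero_mul]
          · rw [map_mul, h q hq, mul_zero]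
        · intro h
          by_contra hcon
          simp only [zeroLocus, Set.mem_union, Set.mem_ofPred_eq, not_or, not_forall] at hcon
          obtain ⟨⟨p, hp, hp0⟩, ⟨q, hq, hq0⟩⟩ := hcon
          have := h (p * q) ⟨p, hp, q, hq, rfl⟩
          rw [map_mul, mul_eq_zero] at this
          exact this.elim hp0 hq0)

/-- The multiplicity of the point `p` in the arrangement `A`: the number of lines through `p`. -/
def multiplicity (A : LineTuple n) (p : Plane) : ℕ := {i | p ∈ linePoints (A i)}.ncard

/-- `L(A) = L(B)`: for every nonempty set `S` of indices, the intersections of the lines indexed by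
`S` in `A` and in `B` have the same dimension. (The projective dimension is the linear one minus
one, the empty set having dimension `-1`.) -/
def SameLattice (A B : LineTuple n) : Prop :=
  ∀ S : Finset (Fin n), S.Nonempty →
    Module.finrank ℂ (⨅ i ∈ S, lineSubmodule (A i) : Submodule ℂ (Fin 3 → ℂ)) =
      Module.finrank ℂ (⨅ i ∈ S, lineSubmodule (B i) : Submodule ℂ (Fin 3 → ℂ))

/-- The space `{B ∈ ((ℂℙ²)^*)ⁿ | L(B) = L(A)}`, with the Zariski topology induced from
`((ℂℙ²)^*)ⁿ`. -/
abbrev RealizationSpace (A : LineTuple n) : Type := {B : LineTuple n // SameLattice B A}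

/-- Two tuples of lines are projectively equivalent if an element of `PGL(3, ℂ)`, acting on
`ℂℙ²`, carries the `i`-th line of the first onto the `i`-th line of the second for every `i`. -/
def projectiveSetoid (A : LineTuple n) : Setoid (RealizationSpace A) where
  r B C := ∃ g : PGL(3, ℂ), ∀ i,
    (fun p : Plane => g • p) '' linePoints (B.1 i) = linePoints (C.1 i)
  iseqv :=
    { refl := fun B => ⟨1, fun i => by simp⟩
      symm := by
        rintro B C ⟨g, hg⟩
        refine ⟨g⁻¹, fun i => ?_⟩
        rw [← hg i, Set.image_image]
        simp
      trans := by
        rintro B C D ⟨g, hg⟩ ⟨h, hh⟩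
        refine ⟨h * g, fun i => ?_⟩
        rw [← hh i, ← hg i, Set.image_image]
        simp [mul_smul] }

/-- The (ordered) moduli space `M_A = {B ∈ ((ℂℙ²)^*)ⁿ | L(B) = L(A)} / PGL(3, ℂ)`, with the
quotient of the Zariski topology. -/
abbrev ModuliSpace (A : LineTuple n) : Type := Quotient (projectiveSetoid A)

end LineArrangement

end

noncomputable section

namespace LineArrangement

open scoped LinearAlgebra.Projectivization MatrixGroups Matrix
open Polynomial

variable {n : ℕ}

/-! At most four lines miss the point p of high multiplicity. Write lines by coefficient vectors, so
that three lines are concurrent exactly when their triple product vanishes. The lattice then amounts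
to closed conditions (vanishing triple products) and open ones (distinct lines, nonvanishing triple
products), see `sameLattice_iff`.

To show that two nonempty open sets of the moduli space meet, it is enough to join suitable
representatives of two realizations by a polynomial curve along which all closed conditions hold
identically. The open conditions hold at t = 0, hence for all but finitely many t, and so does
membership in each of the two open sets (`exists_mem_inter_of_curve`).

Scale the lines missing p so that their forms take the value 1 at a vector u over p. After a change
of coordinates in each realization, u is common to both and the lines missing p differ by multiples
of one vector m. If these lines are concurrent, they become (1, 0, *); otherwise three of them
become the coordinate lines and only a fourth can move. Moving along m makes triple products affine
in t, since terms with two copies of m cancel; vanishing at t = 0 and t = 1 thus gives vanishing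
throughout. A line through p and through the intersection of lines a and b is forced to be the
difference of their normalized equations, so it follows the motion; the other lines through p move
freely in the pencil (`exists_curve`). -/

/-! ### Lines as coefficient vectors -/

/-- The triple product of three vectors, i.e. their determinant. -/
def tripleProduct {R : Type*} [CommRing R] (a b c : Fin 3 → R) : R := a ⬝ᵥ b ⨯₃ c

theorem tripleProduct_eq {R : Type*} [CommRing R] (a b c : Fin 3 → R) :
    tripleProduct a b c = a 0 * (b 1 * c 2 - b 2 * c 1) + a 1 * (b 2 * c 0 - b 0 * c 2) +
      a 2 * (b 0 * c 1 - b 1 * c 0) := by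
  rw [tripleProduct, Matrix.vec3_dotProduct, cross_apply]
  simp only [Matrix.cons_val]

/-- The linear form with coefficient vector `v`. -/
abbrev form (v : Fin 3 → ℂ) : Module.Dual ℂ (Fin 3 → ℂ) := dotProductEquiv ℂ (Fin 3) v

theorem form_smul (c : ℂ) (v : Fin 3 → ℂ) : form (c • v) = c • form v :=
  map_smul (dotProductEquiv ℂ (Fin 3)) c v

theorem form_ne_zero {v : Fin 3 → ℂ} (hv : v ≠ 0) : form v ≠ 0 :=
  (dotProductEquiv ℂ (Fin 3)).map_ne_zero_iff.mpr hv

/-- The `i`-th line of `B` has the equation with coefficient vector `v i`. -/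
def Represents (v : Fin n → Fin 3 → ℂ) (B : LineTuple n) : Prop :=
  ∀ i, ∃ h : v i ≠ 0, B i = Projectivization.mk ℂ (form (v i)) (form_ne_zero h)

theorem exists_represents (B : LineTuple n) : ∃ v, Represents v B := by
  refine ⟨fun i => (dotProductEquiv ℂ (Fin 3)).symm (B i).rep, fun i => ⟨?_, ?_⟩⟩
  · exact (dotProductEquiv ℂ (Fin 3)).symm.map_ne_zero_iff.mpr (B i).rep_nonzero
  · conv_lhs => rw [← (B i).mk_rep]
    congr 1
    exact ((dotProductEquiv ℂ (Fin 3)).apply_symm_apply _).symm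

theorem exists_lineTuple_represents {v : Fin n → Fin 3 → ℂ} (hv : ∀ i, v i ≠ 0) :
    ∃ B : LineTuple n, Represents v B :=
  ⟨fun i => Projectivization.mk ℂ (form (v i)) (form_ne_zero (hv i)), fun i => ⟨hv i, rfl⟩⟩

theorem Represents.smul {v w : Fin n → Fin 3 → ℂ} {B : LineTuple n} (h : Represents v B)
    (hw : ∀ i, ∃ c : ℂ, c ≠ 0 ∧ w i = c • v i) : Represents w B := by
  intro i
  obtain ⟨h0, h1⟩ := h i
  obtain ⟨c, hc, hcw⟩ := hw i
  have hwi : w i ≠ 0 := by rw [hcw]; exact smul_ne_zero hc h0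
  refine ⟨hwi, ?_⟩
  rw [h1, Projectivization.mk_eq_mk_iff']
  exact ⟨c⁻¹, by rw [hcw, form_smul, smul_smul, inv_mul_cancel₀ hc, one_smul]⟩

theorem Represents.lineSubmodule_eq {v : Fin n → Fin 3 → ℂ} {B : LineTuple n} (h : Represents v B)
    (i : Fin n) : lineSubmodule (B i) = LinearMap.ker (form (v i)) := by
  obtain ⟨h0, h1⟩ := h i
  obtain ⟨a, ha⟩ := Projectivization.exists_smul_eq_mk_rep ℂ (form (v i)) (form_ne_zero h0)
  ext x
  rw [lineSubmodule, h1, ← ha, LinearMap.mem_ker, LinearMap.mem_ker, LinearMap.smul_apply,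
    smul_eq_zero_iff_eq]

theorem Represents.mem_lineSubmodule {v : Fin n → Fin 3 → ℂ} {B : LineTuple n}
    (h : Represents v B) {i : Fin n} {x : Fin 3 → ℂ} :
    x ∈ lineSubmodule (B i) ↔ v i ⬝ᵥ x = 0 := by
  rw [h.lineSubmodule_eq i]; rfl

/-! ### Intersection dimensions and the lattice in terms of triple products -/

theorem exists_smul_of_cross_eq_zero {a b : Fin 3 → ℂ} (ha : a ≠ 0) (h : a ⨯₃ b = 0) :
    ∃ c : ℂ, b = c • a := by
  by_contra! hc
  exact crossProduct_ne_zero_iff_linearIndependent.mpr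
    ((LinearIndependent.pair_iff' ha).mpr fun c hcb => hc c hcb.symm) h

/-- The expansion (a × b) × x = (a · x) b - (b · x) a vanishes under the two orthogonality
conditions, so x is parallel to a × b. -/
theorem orthogonal_pair_iff {a b x : Fin 3 → ℂ} (h : a ⨯₃ b ≠ 0) :
    (a ⬝ᵥ x = 0 ∧ b ⬝ᵥ x = 0) ↔ ∃ c : ℂ, x = c • (a ⨯₃ b) := by
  constructor
  · rintro ⟨h1, h2⟩
    refine exists_smul_of_cross_eq_zero h ?_
    rw [cross_cross_eq_smul_sub_smul, h1, h2]
    simp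
  · rintro ⟨c, rfl⟩
    simp [dotProduct_smul]

theorem finrank_iInf_lineSubmodule_singleton (B : LineTuple n) (i : Fin n) :
    Module.finrank ℂ (⨅ k ∈ ({i} : Finset (Fin n)), lineSubmodule (B k) :
      Submodule ℂ (Fin 3 → ℂ)) = 2 := by
  have h := Module.Dual.finrank_ker_add_one_of_ne_zero (B i).rep_nonzero
  have he : (⨅ k ∈ ({i} : Finset (Fin n)), lineSubmodule (B k) : Submodule ℂ (Fin 3 → ℂ)) =
      lineSubmodule (B i) := by
    ext x
    simp only [Submodule.mem_iInf, Finset.mem_singleton, forall_eq]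
  rw [he]
  rw [Module.finrank_fin_fun] at h
  exact Nat.succ.inj h

-- Lines i and j meet in the single point v i × v j, so the whole intersection is that point or
-- empty.
open Classical in
theorem Represents.finrank_iInf {v : Fin n → Fin 3 → ℂ} {B : LineTuple n} (h : Represents v B)
    {S : Finset (Fin n)} {i j : Fin n} (hi : i ∈ S) (hj : j ∈ S) (hij : v i ⨯₃ v j ≠ 0) :
    Module.finrank ℂ (⨅ k ∈ S, lineSubmodule (B k) : Submodule ℂ (Fin 3 → ℂ)) =
      if ∀ k ∈ S, tripleProduct (v k) (v i) (v j) = 0 then 1 else 0 := by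
  have hmem : ∀ x, x ∈ (⨅ k ∈ S, lineSubmodule (B k) : Submodule ℂ (Fin 3 → ℂ)) ↔
      ∀ k ∈ S, v k ⬝ᵥ x = 0 := by
    intro x
    simp only [Submodule.mem_iInf, h.mem_lineSubmodule]
  split_ifs with hS
  · rw [← finrank_span_singleton (K := ℂ) hij]
    suffices he : (⨅ k ∈ S, lineSubmodule (B k) : Submodule ℂ (Fin 3 → ℂ)) =
        Submodule.span ℂ {v i ⨯₃ v j} by rw [he]
    ext x
    rw [hmem, Submodule.mem_span_singleton]
    constructor
    · intro hx
      obtain ⟨c, hc⟩ := (orthogonal_pair_iff hij).mp ⟨hx i hi, hx j hj⟩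
      exact ⟨c, hc.symm⟩
    · rintro ⟨c, rfl⟩ k hk
      rw [dotProduct_smul]
      exact (congrArg (c • ·) (hS k hk)).trans (smul_zero c)
  · rw [Submodule.finrank_eq_zero, Submodule.eq_bot_iff]
    intro x hx
    rw [hmem] at hx
    obtain ⟨c, rfl⟩ := (orthogonal_pair_iff hij).mp ⟨hx i hi, hx j hj⟩
    by_contra hne
    refine hS fun k hk => ?_
    have := hx k hk
    rw [dotProduct_smul, smul_eq_mul, mul_eq_zero] at this
    exact this.resolve_left fun hc => hne (by rw [hc, zero_smul])

theorem Represents.cross_ne_zero {w : Fin n → Fin 3 → ℂ} {A : LineTuple n} (h : Represents w A)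
    (hA : Function.Injective A) {i j : Fin n} (hij : i ≠ j) : w i ⨯₃ w j ≠ 0 := by
  intro h0
  obtain ⟨hi, hi'⟩ := h i
  obtain ⟨hj, hj'⟩ := h j
  obtain ⟨c, hc⟩ := exists_smul_of_cross_eq_zero hi h0
  refine hij (hA ?_).symm
  rw [hi', hj', Projectivization.mk_eq_mk_iff']
  exact ⟨c, by rw [hc, form_smul]⟩

theorem tripleProduct_self_left {R : Type*} [CommRing R] (a b : Fin 3 → R) :
    tripleProduct a a b = 0 := by rw [tripleProduct_eq]; ring

theorem tripleProduct_self_right {R : Type*} [CommRing R] (a b : Fin 3 → R) :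
    tripleProduct a b b = 0 := by rw [tripleProduct_eq]; ring

/-- Once the lines are distinct, two of them cut out a point, and every larger intersection is
decided by which further lines contain it; triples therefore determine the lattice. -/
theorem sameLattice_iff {v w : Fin n → Fin 3 → ℂ} {A B : LineTuple n} (hv : Represents v B)
    (hw : Represents w A) (hA : Function.Injective A) :
    SameLattice B A ↔ (∀ i j, i ≠ j → v i ⨯₃ v j ≠ 0) ∧
      ∀ i j k, tripleProduct (v i) (v j) (v k) = 0 ↔ tripleProduct (w i) (w j) (w k) = 0 := by
  classical
  constructor
  · intro h
    have hcross : ∀ i j, i ≠ j → v i ⨯₃ v j ≠ 0 := by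
      intro i j hij h0
      -- Otherwise lines i and j of B coincide and meet in linear dimension 2, whereas those of A
      -- meet in dimension at most 1.
      obtain ⟨c, hc⟩ := exists_smul_of_cross_eq_zero (hv i).1 h0
      have h1 := h {i, j} (Finset.insert_nonempty _ _)
      rw [hw.finrank_iInf (i := i) (j := j) (by simp) (by simp) (hw.cross_ne_zero hA hij)] at h1
      have h2 := finrank_iInf_lineSubmodule_singleton B i
      have h3 : (⨅ k ∈ ({i} : Finset (Fin n)), lineSubmodule (B k) : Submodule ℂ (Fin 3 → ℂ)) ≤
          ⨅ k ∈ ({i, j} : Finset (Fin n)), lineSubmodule (B k) := by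
        intro x hx
        simp only [Submodule.mem_iInf, Finset.mem_singleton, Finset.mem_insert, forall_eq,
          forall_eq_or_imp, hv.mem_lineSubmodule] at hx ⊢
        exact ⟨hx, by rw [hc, smul_dotProduct, hx, smul_zero]⟩
      have h4 := Submodule.finrank_mono h3
      rw [h2, h1] at h4
      split_ifs at h4 <;> omega
    refine ⟨hcross, fun i j k => ?_⟩
    rcases eq_or_ne j k with rfl | hjk
    · simp [tripleProduct_self_right]
    · have h1 := h {i, j, k} (Finset.insert_nonempty _ _)
      rw [hw.finrank_iInf (i := j) (j := k) (by simp) (by simp) (hw.cross_ne_zero hA hjk),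
        hv.finrank_iInf (i := j) (j := k) (by simp) (by simp) (hcross j k hjk)] at h1
      have key : ∀ u : Fin n → Fin 3 → ℂ,
          (∀ l ∈ ({i, j, k} : Finset (Fin n)), tripleProduct (u l) (u j) (u k) = 0) ↔
            tripleProduct (u i) (u j) (u k) = 0 := by
        intro u
        simp only [Finset.mem_insert, Finset.mem_singleton, forall_eq_or_imp, forall_eq,
          tripleProduct_self_left, true_and, and_iff_left_iff_imp]
        intro _
        rw [tripleProduct_eq]; ring
      simp only [key] at h1
      split_ifs at h1 with h2 h3 h3 <;> simp_all
  · rintro ⟨hcross, hdet⟩ S hS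
    by_cases hcard : ∃ i ∈ S, ∃ j ∈ S, i ≠ j
    · obtain ⟨i, hi, j, hj, hij⟩ := hcard
      rw [hw.finrank_iInf hi hj (hw.cross_ne_zero hA hij), hv.finrank_iInf hi hj (hcross i j hij)]
      simp only [hdet]
    · push Not at hcard
      obtain ⟨i, hi⟩ := hS
      obtain rfl : S = {i} := Finset.eq_singleton_iff_unique_mem.mpr
        ⟨hi, fun j hj => hcard j hj i hi⟩
      rw [finrank_iInf_lineSubmodule_singleton, finrank_iInf_lineSubmodule_singleton]

theorem Represents.eval_coords_eq_zero_iff {v : Fin n → Fin 3 → ℂ} {B : LineTuple n}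
    (h : Represents v B) {p : MvPolynomial (Fin n × Fin 3) ℂ} (hp : IsMultihomogeneous p) :
    MvPolynomial.eval (coords B) p = 0 ↔
      MvPolynomial.eval (fun x : Fin n × Fin 3 => v x.1 x.2) p = 0 := by
  rw [LineArrangement.eval_coords_eq_zero_iff hp B (fun i => form (v i))
    (fun i => form_ne_zero (h i).1) (fun i => (h i).2)]
  simp [form]

/-! ### Zariski-open conditions along polynomial curves -/

theorem exists_nonvanishing_of_isOpen {U : Set (LineTuple n)} (hU : IsOpen U) {B : LineTuple n}
    (hB : B ∈ U) : ∃ p : MvPolynomial (Fin n × Fin 3) ℂ, IsMultihomogeneous p ∧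
      MvPolynomial.eval (coords B) p ≠ 0 ∧
        ∀ D : LineTuple n, MvPolynomial.eval (coords D) p ≠ 0 → D ∈ U := by
  obtain ⟨S, hS, hSU⟩ : Uᶜ ∈ {Z | ∃ S : Set (MvPolynomial (Fin n × Fin 3) ℂ),
      (∀ p ∈ S, IsMultihomogeneous p) ∧ Z = zeroLocus S} := hU
  have hB' : B ∉ zeroLocus S := by rw [← hSU]; exact fun h => h hB
  simp only [zeroLocus, Set.mem_ofPred_eq, not_forall] at hB'
  obtain ⟨p, hpS, hp⟩ := hB'
  refine ⟨p, hS p hpS, hp, fun D hD => ?_⟩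
  by_contra hDU
  have : D ∈ zeroLocus S := by rw [← hSU]; exact hDU
  exact hD (this p hpS)

/-- The value at `t` of a family of triples of polynomials. -/
def evalAt (f : Fin n → Fin 3 → ℂ[X]) (t : ℂ) (i : Fin n) (j : Fin 3) : ℂ := (f i j).eval t

theorem eventually_eval_ne_zero {p : ℂ[X]} {t₀ : ℂ} (h : p.eval t₀ ≠ 0) :
    ∀ᶠ t in Filter.cofinite, p.eval t ≠ 0 := by
  have hp : p ≠ 0 := by rintro rfl; simp at h
  refine (Polynomial.finite_setOfPred_isRoot hp).subset fun t ht => ?_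
  simpa using ht

/-- Substituting the curve into p gives a polynomial in t, which has finitely many roots unless it
is zero. -/
theorem eventually_mvPolynomial_eval_ne_zero {f : Fin n → Fin 3 → ℂ[X]} {t₀ : ℂ}
    {p : MvPolynomial (Fin n × Fin 3) ℂ}
    (h : MvPolynomial.eval (fun x => evalAt f t₀ x.1 x.2) p ≠ 0) :
    ∀ᶠ t in Filter.cofinite, MvPolynomial.eval (fun x => evalAt f t x.1 x.2) p ≠ 0 := by
  have key : ∀ t, (MvPolynomial.eval₂ C (fun x : Fin n × Fin 3 => f x.1 x.2) p).eval t =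
      MvPolynomial.eval (fun x => evalAt f t x.1 x.2) p := by
    intro t
    rw [← coe_evalRingHom, MvPolynomial.hom_eval₂, MvPolynomial.eval, MvPolynomial.coe_eval₂Hom]
    congr 1
    ext; simp
  simp only [← key] at h ⊢
  exact eventually_eval_ne_zero h

theorem eventually_tripleProduct_ne_zero {f : Fin n → Fin 3 → ℂ[X]} {t₀ : ℂ} {i j k : Fin n}
    (h : tripleProduct (evalAt f t₀ i) (evalAt f t₀ j) (evalAt f t₀ k) ≠ 0) :
    ∀ᶠ t in Filter.cofinite,
      tripleProduct (evalAt f t i) (evalAt f t j) (evalAt f t k) ≠ 0 := by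
  have key : ∀ t, (tripleProduct (f i) (f j) (f k)).eval t =
      tripleProduct (evalAt f t i) (evalAt f t j) (evalAt f t k) := by
    intro t
    simp [tripleProduct_eq, evalAt]
  simp only [← key] at h ⊢
  exact eventually_eval_ne_zero h

theorem eventually_cross_ne_zero {f : Fin n → Fin 3 → ℂ[X]} {t₀ : ℂ} {i j : Fin n}
    (h : evalAt f t₀ i ⨯₃ evalAt f t₀ j ≠ 0) :
    ∀ᶠ t in Filter.cofinite, evalAt f t i ⨯₃ evalAt f t j ≠ 0 := by
  obtain ⟨k, hk⟩ := Function.ne_iff.mp h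
  have key : ∀ t, ((f i ⨯₃ f j) k).eval t = (evalAt f t i ⨯₃ evalAt f t j) k := by
    intro t
    rw [cross_apply, cross_apply]
    fin_cases k <;> simp [evalAt]
  rw [← key] at hk
  filter_upwards [eventually_eval_ne_zero hk] with t ht h0
  rw [key, h0] at ht
  exact ht rfl

theorem eventually_ne_zero {f : Fin n → Fin 3 → ℂ[X]} {t₀ : ℂ} {i : Fin n}
    (h : evalAt f t₀ i ≠ 0) : ∀ᶠ t in Filter.cofinite, evalAt f t i ≠ 0 := by
  obtain ⟨k, hk⟩ := Function.ne_iff.mp h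
  filter_upwards [eventually_eval_ne_zero (p := f i k) hk] with t ht h0
  exact ht (congrFun h0 k)

/-- If a polynomial curve of tuples of lines joins two realizations of the lattice of `A` and
satisfies identically all the collinearities of `A`, then any two open neighbourhoods of the two
realizations have a realization in common. -/
theorem exists_mem_inter_of_curve {A B C : LineTuple n} (hA : Function.Injective A)
    {w : Fin n → Fin 3 → ℂ} (hw : Represents w A) (f : Fin n → Fin 3 → ℂ[X])
    (hB : SameLattice B A) (hfB : Represents (evalAt f 0) B) (hfC : Represents (evalAt f 1) C)
    (hf : ∀ t i j k, tripleProduct (w i) (w j) (w k) = 0 →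
      tripleProduct (evalAt f t i) (evalAt f t j) (evalAt f t k) = 0)
    {U V : Set (LineTuple n)} (hU : IsOpen U) (hV : IsOpen V) (hBU : B ∈ U) (hCV : C ∈ V) :
    ∃ D, SameLattice D A ∧ D ∈ U ∧ D ∈ V := by
  obtain ⟨p, hp, hpB, hpU⟩ := exists_nonvanishing_of_isOpen hU hBU
  obtain ⟨q, hq, hqC, hqV⟩ := exists_nonvanishing_of_isOpen hV hCV
  -- The open lattice conditions are propagated from t = 0; the endpoint C serves only to make q
  -- nonzero at t = 1.
  obtain ⟨hcross, hdep⟩ := (sameLattice_iff hfB hw hA).mp hB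
  have h1 : ∀ᶠ t in Filter.cofinite, ∀ i, evalAt f t i ≠ 0 :=
    Filter.eventually_all.mpr fun i => eventually_ne_zero (hfB i).1
  have h2 : ∀ᶠ t in Filter.cofinite, ∀ i j, i ≠ j → evalAt f t i ⨯₃ evalAt f t j ≠ 0 := by
    refine Filter.eventually_all.mpr fun i => Filter.eventually_all.mpr fun j => ?_
    by_cases hij : i = j
    · exact Filter.Eventually.of_forall fun t h => absurd hij h
    · filter_upwards [eventually_cross_ne_zero (hcross i j hij)] with t ht _ using ht
  have h3 : ∀ᶠ t in Filter.cofinite, ∀ i j k, tripleProduct (w i) (w j) (w k) ≠ 0 →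
      tripleProduct (evalAt f t i) (evalAt f t j) (evalAt f t k) ≠ 0 := by
    refine Filter.eventually_all.mpr fun i => Filter.eventually_all.mpr fun j =>
      Filter.eventually_all.mpr fun k => ?_
    by_cases hijk : tripleProduct (w i) (w j) (w k) = 0
    · exact Filter.Eventually.of_forall fun t h => absurd hijk h
    · filter_upwards [eventually_tripleProduct_ne_zero (mt (hdep i j k).mp hijk)] with t ht _
        using ht
  have h4 := eventually_mvPolynomial_eval_ne_zero (mt (hfB.eval_coords_eq_zero_iff hp).mpr hpB)
  have h5 := eventually_mvPolynomial_eval_ne_zero (mt (hfC.eval_coords_eq_zero_iff hq).mpr hqC)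
  -- Since ℂ is infinite, finitely many cofinite conditions have a common solution.
  obtain ⟨t, h1, h2, h3, h4, h5⟩ := (h1.and (h2.and (h3.and (h4.and h5)))).exists
  obtain ⟨D, hD⟩ := exists_lineTuple_represents h1
  refine ⟨D, (sameLattice_iff hD hw hA).mpr ⟨h2, fun i j k => ⟨?_, hf t i j k⟩⟩,
    hpU D (mt (hD.eval_coords_eq_zero_iff hp).mp h4),
    hqV D (mt (hD.eval_coords_eq_zero_iff hq).mp h5)⟩
  contrapose!
  exact h3 i j k

/-! ### Changes of coordinates and projective equivalence -/

theorem tripleProduct_vecMul (a b c : Fin 3 → ℂ) (M : Matrix (Fin 3) (Fin 3) ℂ) :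
    tripleProduct (a ᵥ* M) (b ᵥ* M) (c ᵥ* M) = tripleProduct a b c * M.det := by
  simp only [tripleProduct_eq, Matrix.det_fin_three, Matrix.vecMul, dotProduct, Fin.sum_univ_three]
  ring

theorem cross_vecMul_ne_zero {a b : Fin 3 → ℂ} (h : a ⨯₃ b ≠ 0) (M : GL (Fin 3) ℂ) :
    (a ᵥ* M.1) ⨯₃ (b ᵥ* M.1) ≠ 0 := by
  have hinj : Function.Injective (fun x : Fin 3 → ℂ => x ᵥ* M.1) :=
    Matrix.vecMul_injective_of_isUnit M.isUnit
  rw [crossProduct_ne_zero_iff_linearIndependent] at h ⊢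
  have := h.map' (Matrix.vecMulLinear M.1) (LinearMap.ker_eq_bot.mpr hinj)
  have e : ⇑(Matrix.vecMulLinear M.1) ∘ ![a, b] = ![a ᵥ* M.1, b ᵥ* M.1] := by
    funext i
    fin_cases i <;> rfl
  rw [e] at this
  exact this

/-- Forms transform contravariantly: (v M) · x = v · (M x), so M carries the lines of B' to those of
B. -/
theorem mem_linePoints_smul_iff {v v' : Fin n → Fin 3 → ℂ} {B B' : LineTuple n}
    (hv : Represents v B) (hv' : Represents v' B') {M : GL (Fin 3) ℂ}
    (h : ∀ i, v' i = v i ᵥ* M.1) (i : Fin n) (p : Plane) :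
    (Matrix.ProjGenLinGroup.mk M : PGL(3, ℂ)) • p ∈ linePoints (B i) ↔ p ∈ linePoints (B' i) := by
  induction p using Projectivization.ind with
  | h x hx =>
    have key : ∀ {u : Fin n → Fin 3 → ℂ} {E : LineTuple n}, Represents u E →
        ∀ (y : Fin 3 → ℂ) (hy : y ≠ 0),
          (Projectivization.mk ℂ y hy : Plane) ∈ linePoints (E i) ↔ u i ⬝ᵥ y = 0 := by
      intro u E hu y hy
      obtain ⟨a, ha⟩ := Projectivization.exists_smul_eq_mk_rep ℂ y hy
      change (Projectivization.mk ℂ y hy).rep ∈ lineSubmodule (E i) ↔ _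
      rw [hu.mem_lineSubmodule, ← ha, Units.smul_def, dotProduct_smul, smul_eq_mul, mul_eq_zero,
        or_iff_right a.ne_zero]
    rw [key hv' x hx, h i, ← Matrix.dotProduct_mulVec]
    exact key hv _ _

/-- Changing coordinates gives a projectively equivalent realization. -/
theorem exists_equivalent {A B : LineTuple n} (hA : Function.Injective A)
    (hB : SameLattice B A) {v : Fin n → Fin 3 → ℂ} (hv : Represents v B) (M : GL (Fin 3) ℂ) :
    ∃ (B' : LineTuple n) (hB' : SameLattice B' A), Represents (fun i => v i ᵥ* M.1) B' ∧
      (projectiveSetoid A).r ⟨B', hB'⟩ ⟨B, hB⟩ := by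
  obtain ⟨w, hw⟩ := exists_represents A
  obtain ⟨hcross, hdep⟩ := (sameLattice_iff hv hw hA).mp hB
  have hne : ∀ i, v i ᵥ* M.1 ≠ 0 := fun i h0 =>
    (hv i).1 (Matrix.vecMul_injective_of_isUnit M.isUnit (h0.trans (Matrix.zero_vecMul _).symm))
  obtain ⟨B', hB'⟩ := exists_lineTuple_represents hne
  refine ⟨B', (sameLattice_iff hB' hw hA).mpr ⟨fun i j hij => cross_vecMul_ne_zero
    (hcross i j hij) M, fun i j k => ?_⟩, hB', Matrix.ProjGenLinGroup.mk M, fun i => ?_⟩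
  · rw [tripleProduct_vecMul, mul_eq_zero, hdep i j k, or_iff_left]
    exact (M.1.isUnit_iff_isUnit_det.mp M.isUnit).ne_zero
  · ext p
    constructor
    · rintro ⟨p, hp, rfl⟩
      exact (mem_linePoints_smul_iff hv hB' (fun _ => rfl) i p).mpr hp
    · intro hp
      refine ⟨(Matrix.ProjGenLinGroup.mk M : PGL(3, ℂ))⁻¹ • p, ?_, smul_inv_smul _ _⟩
      rw [← mem_linePoints_smul_iff hv hB' (fun _ => rfl) i, smul_inv_smul]
      exact hp

/-! ### The curve joining two normalized realizations -/

theorem tripleProduct_rotate {R : Type*} [CommRing R] (a b c : Fin 3 → R) :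
    tripleProduct a b c = tripleProduct b c a := by
  rw [tripleProduct_eq, tripleProduct_eq]; ring

theorem tripleProduct_eq_zero_of_orthogonal {u a b c : Fin 3 → ℂ} (hu : u ≠ 0)
    (ha : a ⬝ᵥ u = 0) (hb : b ⬝ᵥ u = 0) (hc : c ⬝ᵥ u = 0) : tripleProduct a b c = 0 := by
  by_cases h : b ⨯₃ c = 0
  · rw [tripleProduct, h, dotProduct_zero]
  · obtain ⟨k, rfl⟩ := (orthogonal_pair_iff h).mp ⟨hb, hc⟩
    rw [dotProduct_smul, smul_eq_mul, mul_eq_zero] at ha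
    exact ha.resolve_left fun hk => hu (by rw [hk, zero_smul])

/-- The vector u is a multiple of a × b, so c · u = 1 prevents c · (a × b) = 0. Geometrically, two
distinct lines through the base point are never concurrent with a line missing it. -/
theorem tripleProduct_ne_zero_of_orthogonal_pair {u a b c : Fin 3 → ℂ} (hab : a ⨯₃ b ≠ 0)
    (ha : a ⬝ᵥ u = 0) (hb : b ⬝ᵥ u = 0) (hc : c ⬝ᵥ u = 1) : tripleProduct a b c ≠ 0 := by
  intro h
  obtain ⟨k, rfl⟩ := (orthogonal_pair_iff hab).mp ⟨ha, hb⟩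
  rw [tripleProduct_rotate, tripleProduct_rotate] at h
  rw [dotProduct_smul, smul_eq_mul, show c ⬝ᵥ a ⨯₃ b = 0 from h, mul_zero] at hc
  exact zero_ne_one hc

/-- A line through the base point which passes through the intersection of two lines not containing
the base point is determined by the difference of their normalized equations. -/
theorem exists_sub_eq_smul {u l a b : Fin 3 → ℂ} (hl : l ≠ 0) (hlu : l ⬝ᵥ u = 0)
    (ha : a ⬝ᵥ u = 1) (hb : b ⬝ᵥ u = 1) (hab : a ⨯₃ b ≠ 0) (h : tripleProduct l a b = 0) :
    ∃ c : ℂ, c ≠ 0 ∧ a - b = c • l := by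
  have hdu : (a - b) ⬝ᵥ u = 0 := by rw [sub_dotProduct, ha, hb, sub_self]
  -- If l and a - b were independent, both being orthogonal to u, then l, a - b, b would be
  -- independent; but their triple product equals that of l, a, b.
  have h0 : l ⨯₃ (a - b) = 0 := by
    by_contra hne
    refine tripleProduct_ne_zero_of_orthogonal_pair hne hlu hdu hb ?_
    rw [← h]
    simp only [tripleProduct_eq, Pi.sub_apply]
    ring
  obtain ⟨c, hc⟩ := exists_smul_of_cross_eq_zero hl h0
  refine ⟨c, ?_, hc⟩
  rintro rfl
  rw [zero_smul, sub_eq_zero] at hc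
  rw [hc, cross_self] at hab
  exact hab rfl

/-- The triple product is affine along a family moving in a single direction. -/
theorem tripleProduct_affine (a b c m : Fin 3 → ℂ) (r s q t : ℂ) :
    tripleProduct (a + t • r • m) (b + t • s • m) (c + t • q • m) =
      (1 - t) * tripleProduct a b c +
        t * tripleProduct (a + r • m) (b + s • m) (c + q • m) := by
  simp only [tripleProduct_eq, Pi.add_apply, Pi.smul_apply, smul_eq_mul]
  ring

/-- The linear interpolation between two families of vectors. -/
def segment (v v' : Fin n → Fin 3 → ℂ) (i : Fin n) (j : Fin 3) : ℂ[X] :=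
  C (v i j) + X * C (v' i j - v i j)

theorem evalAt_segment (v v' : Fin n → Fin 3 → ℂ) (t : ℂ) (i : Fin n) :
    evalAt (segment v v') t i = v i + t • (v' i - v i) := by
  ext j
  simp [evalAt, segment]

/-- Two realizations in normal form with respect to a base point `u` are joined by a curve: the
lines not through the base point move in a single direction `m`, and the lines through the base
point follow them. -/
theorem exists_curve {A B B' : LineTuple n} (hA : Function.Injective A)
    {w v v' : Fin n → Fin 3 → ℂ} (hw : Represents w A) (hv : Represents v B)
    (hv' : Represents v' B') (hB : SameLattice B A) (hB' : SameLattice B' A)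
    (P : Fin n → Prop) {u m : Fin 3 → ℂ} (hu : u ≠ 0)
    (hvu : ∀ i, P i → v i ⬝ᵥ u = 0) (hvu1 : ∀ i, ¬ P i → v i ⬝ᵥ u = 1)
    (hvu' : ∀ i, P i → v' i ⬝ᵥ u = 0) (hvu1' : ∀ i, ¬ P i → v' i ⬝ᵥ u = 1)
    (hm : ∀ i, ¬ P i → ∃ c : ℂ, v' i - v i = c • m) :
    ∃ f : Fin n → Fin 3 → ℂ[X], Represents (evalAt f 0) B ∧ Represents (evalAt f 1) B' ∧
      ∀ t i j k, tripleProduct (w i) (w j) (w k) = 0 →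
        tripleProduct (evalAt f t i) (evalAt f t j) (evalAt f t k) = 0 := by
  classical
  obtain ⟨hcross, hdep⟩ := (sameLattice_iff hv hw hA).mp hB
  obtain ⟨hcross', hdep'⟩ := (sameLattice_iff hv' hw hA).mp hB'
  let Q : Fin n → Fin n × Fin n → Prop := fun l x => ¬ P x.1 ∧ ¬ P x.2 ∧ x.1 ≠ x.2 ∧
    tripleProduct (w l) (w x.1) (w x.2) = 0
  -- A line through the base point that meets two others off it in a common point is recovered from
  -- their difference, for any choice of such a pair; every other line is interpolated linearly.
  let f : Fin n → Fin 3 → ℂ[X] := fun l =>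
    if h : P l ∧ ∃ x, Q l x then segment v v' h.2.choose.1 - segment v v' h.2.choose.2
    else segment v v' l
  have hf1 : ∀ l, P l → (∃ x, Q l x) → ∃ x, Q l x ∧ ∀ t, evalAt f t l =
      evalAt (segment v v') t x.1 - evalAt (segment v v') t x.2 := by
    intro l hl hx
    refine ⟨hx.choose, hx.choose_spec, fun t => ?_⟩
    ext j
    simp only [evalAt, f, dif_pos (And.intro hl hx), Pi.sub_apply, eval_sub]
  have hf2 : ∀ l, ¬ (P l ∧ ∃ x, Q l x) → ∀ t, evalAt f t l = evalAt (segment v v') t l := by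
    intro l hl t
    ext j
    simp only [evalAt, f, dif_neg hl]
  have hseg0 : ∀ i, evalAt (segment v v') 0 i = v i := fun i => by simp [evalAt_segment]
  have hseg1 : ∀ i, evalAt (segment v v') 1 i = v' i := fun i => by simp [evalAt_segment]
  have hfP : ∀ l, P l → ∀ t, evalAt f t l ⬝ᵥ u = 0 := by
    intro l hl t
    by_cases hx : ∃ x, Q l x
    · obtain ⟨x, hxQ, hx⟩ := hf1 l hl hx
      rw [hx, evalAt_segment, evalAt_segment]
      simp only [sub_dotProduct, add_dotProduct, smul_dotProduct, hvu1 _ hxQ.1, hvu1 _ hxQ.2.1,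
        hvu1' _ hxQ.1, hvu1' _ hxQ.2.1]
      simp
    · rw [hf2 l (fun h => hx h.2), evalAt_segment]
      simp only [sub_dotProduct, add_dotProduct, smul_dotProduct, hvu _ hl, hvu' _ hl]
      simp
  have hO : ∀ l, ¬ P l → ∀ t, evalAt f t l = v l + t • (v' l - v l) := fun l hl t => by
    rw [hf2 l (fun h => hl h.1), evalAt_segment]
  have hPPO : ∀ t i j k, P i → P j → ¬ P k → tripleProduct (w i) (w j) (w k) = 0 →
      tripleProduct (evalAt f t i) (evalAt f t j) (evalAt f t k) = 0 := by
    intro t i j k hi hj hk h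
    rcases eq_or_ne i j with rfl | hij
    · exact tripleProduct_self_left _ _
    · exact absurd ((hdep i j k).mpr h) (tripleProduct_ne_zero_of_orthogonal_pair
        (hcross i j hij) (hvu i hi) (hvu j hj) (hvu1 k hk))
  have hPOO : ∀ t i j k, P i → ¬ P j → ¬ P k → tripleProduct (w i) (w j) (w k) = 0 →
      tripleProduct (evalAt f t i) (evalAt f t j) (evalAt f t k) = 0 := by
    intro t i j k hi hj hk h
    rcases eq_or_ne j k with rfl | hjk
    · exact tripleProduct_self_right _ _
    -- The pair (a, b) chosen to define line i may differ from (j, k). The difference of a and b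
    -- still moves along m, so the triple product is affine in t, and at both endpoints the
    -- difference is a multiple of the original vector of line i.
    · obtain ⟨⟨a, b⟩, hQ, hx⟩ := hf1 i hi ⟨(j, k), hj, hk, hjk, h⟩
      obtain ⟨ha, hb, hab, habw⟩ := hQ
      obtain ⟨r, hr⟩ := hm a ha
      obtain ⟨s, hs⟩ := hm b hb
      obtain ⟨p, hp⟩ := hm j hj
      obtain ⟨q, hq⟩ := hm k hk
      have e : evalAt (segment v v') t a - evalAt (segment v v') t b =
          (v a - v b) + t • (r - s) • m := by
        rw [evalAt_segment, evalAt_segment, hr, hs]; module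
      have e' : (v a - v b) + (r - s) • m = v' a - v' b := by
        rw [sub_smul, ← hr, ← hs]; module
      rw [hx, e, hO j hj, hO k hk, hp, hq, tripleProduct_affine, e', ← hp, ← hq,
        add_sub_cancel, add_sub_cancel]
      obtain ⟨c, -, hc⟩ := exists_sub_eq_smul (hv i).1 (hvu i hi) (hvu1 a ha) (hvu1 b hb)
        (hcross a b hab) ((hdep i a b).mpr habw)
      obtain ⟨c', -, hc'⟩ := exists_sub_eq_smul (hv' i).1 (hvu' i hi) (hvu1' a ha) (hvu1' b hb)
        (hcross' a b hab) ((hdep' i a b).mpr habw)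
      have smul_left : ∀ (c : ℂ) (x y z : Fin 3 → ℂ),
          tripleProduct (c • x) y z = c * tripleProduct x y z := by
        intro c x y z
        rw [tripleProduct, smul_dotProduct, smul_eq_mul, tripleProduct]
      rw [hc, hc', smul_left, smul_left, (hdep i j k).mpr h, (hdep' i j k).mpr h]
      ring
  refine ⟨f, ?_, ?_, fun t i j k h => ?_⟩
  · refine hv.smul fun l => ?_
    by_cases hl : P l ∧ ∃ x, Q l x
    · obtain ⟨x, ⟨hx1, hx2, hx3, hx4⟩, hx⟩ := hf1 l hl.1 hl.2
      rw [hx, hseg0, hseg0]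
      exact exists_sub_eq_smul (hv l).1 (hvu l hl.1) (hvu1 _ hx1) (hvu1 _ hx2) (hcross _ _ hx3)
        ((hdep _ _ _).mpr hx4)
    · exact ⟨1, one_ne_zero, by rw [hf2 l hl, hseg0, one_smul]⟩
  · refine hv'.smul fun l => ?_
    by_cases hl : P l ∧ ∃ x, Q l x
    · obtain ⟨x, ⟨hx1, hx2, hx3, hx4⟩, hx⟩ := hf1 l hl.1 hl.2
      rw [hx, hseg1, hseg1]
      exact exists_sub_eq_smul (hv' l).1 (hvu' l hl.1) (hvu1' _ hx1) (hvu1' _ hx2)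
        (hcross' _ _ hx3) ((hdep' _ _ _).mpr hx4)
    · exact ⟨1, one_ne_zero, by rw [hf2 l hl, hseg1, one_smul]⟩
  · by_cases hi : P i <;> by_cases hj : P j <;> by_cases hk : P k
    · exact tripleProduct_eq_zero_of_orthogonal hu (hfP i hi t) (hfP j hj t) (hfP k hk t)
    · exact hPPO t i j k hi hj hk h
    · rw [tripleProduct_rotate, tripleProduct_rotate] at h ⊢
      exact hPPO t k i j hk hi hj h
    · exact hPOO t i j k hi hj hk h
    · rw [tripleProduct_rotate] at h ⊢
      exact hPPO t j k i hj hk hi h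
    · rw [tripleProduct_rotate] at h ⊢
      exact hPOO t j k i hj hk hi h
    · rw [tripleProduct_rotate, tripleProduct_rotate] at h ⊢
      exact hPOO t k i j hk hi hj h
    · obtain ⟨p, hp⟩ := hm i hi
      obtain ⟨q, hq⟩ := hm j hj
      obtain ⟨r, hr⟩ := hm k hk
      rw [hO i hi, hO j hj, hO k hk, hp, hq, hr, tripleProduct_affine, ← hp, ← hq, ← hr,
        add_sub_cancel, add_sub_cancel, add_sub_cancel, (hdep i j k).mpr h, (hdep' i j k).mpr h]
      ring

/-! ### Normal forms of a realization -/

/-- The base point of B is the intersection u of its lines `i₀` and `j₀`; equality of lattices makes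
`P` describe the lines of B through it. A form not vanishing at u can be rescaled to the value 1. -/
theorem exists_normalized {A B : LineTuple n} (hA : Function.Injective A)
    {w : Fin n → Fin 3 → ℂ} (hw : Represents w A) (hB : SameLattice B A) {P : Fin n → Prop}
    {i₀ j₀ : Fin n} (hij : i₀ ≠ j₀) (hP : ∀ i, P i ↔ tripleProduct (w i) (w i₀) (w j₀) = 0) :
    ∃ v : Fin n → Fin 3 → ℂ, Represents v B ∧ ∃ u : Fin 3 → ℂ, u ≠ 0 ∧
      (∀ i, P i → v i ⬝ᵥ u = 0) ∧ ∀ i, ¬ P i → v i ⬝ᵥ u = 1 := by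
  classical
  obtain ⟨v, hv⟩ := exists_represents B
  obtain ⟨hcross, hdep⟩ := (sameLattice_iff hv hw hA).mp hB
  have hP' : ∀ i, P i ↔ v i ⬝ᵥ v i₀ ⨯₃ v j₀ = 0 := fun i => (hP i).trans (hdep i i₀ j₀).symm
  refine ⟨fun i => (if P i then 1 else (v i ⬝ᵥ v i₀ ⨯₃ v j₀)⁻¹) • v i, hv.smul fun i => ?_,
    v i₀ ⨯₃ v j₀, hcross i₀ j₀ hij, fun i hi => ?_, fun i hi => ?_⟩
  · refine ⟨_, ?_, rfl⟩
    split_ifs with hi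
    · exact one_ne_zero
    · exact inv_ne_zero (mt (hP' i).mpr hi)
  · simp only [if_pos hi, one_smul]
    exact (hP' i).mp hi
  · simp only [if_neg hi, smul_dotProduct, smul_eq_mul]
    exact inv_mul_cancel₀ (mt (hP' i).mpr hi)

theorem exists_cross_ne_zero {u : Fin 3 → ℂ} (hu : u ≠ 0) : ∃ x : Fin 3 → ℂ, u ⨯₃ x ≠ 0 := by
  by_contra! h
  refine hu (funext fun i => ?_)
  have h0 := h ![1, 0, 0]
  have h1 := h ![0, 1, 0]
  simp [cross_apply] at h0 h1
  fin_cases i <;> simp [h0, h1]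

/-- If the lines not through the base point `u` are concurrent, coordinates can be chosen in which
their normalized equations differ in the last coefficient only. -/
theorem exists_coordinates_of_concurrent {v : Fin n → Fin 3 → ℂ} {P : Fin n → Prop}
    {u : Fin 3 → ℂ} (hu : u ≠ 0) (hcross : ∀ i j, i ≠ j → v i ⨯₃ v j ≠ 0) {i₀ : Fin n}
    (hi₀ : P i₀) (hvu1 : ∀ i, ¬ P i → v i ⬝ᵥ u = 1)
    (hdep : ∀ i j k, ¬ P i → ¬ P j → ¬ P k → tripleProduct (v i) (v j) (v k) = 0) :
    ∃ M : GL (Fin 3) ℂ, (∀ i, (v i ᵥ* M.1) 0 = v i ⬝ᵥ u) ∧ ∀ i, ¬ P i → (v i ᵥ* M.1) 1 = 0 := by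
  obtain ⟨x, hx, hvx⟩ : ∃ x : Fin 3 → ℂ, u ⨯₃ x ≠ 0 ∧ ∀ i, ¬ P i → v i ⬝ᵥ x = 0 := by
    by_cases hO : ∃ a, ¬ P a
    · obtain ⟨a, ha⟩ := hO
      obtain ⟨b, hab, hb⟩ : ∃ b, a ≠ b ∧
          ∀ i, ¬ P i → tripleProduct (v i) (v a) (v b) = 0 := by
        by_cases hO' : ∃ b, ¬ P b ∧ a ≠ b
        · obtain ⟨b, hb, hab⟩ := hO'
          exact ⟨b, hab, fun i hi => hdep i a b hi ha hb⟩
        · push Not at hO'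
          -- If only one line misses the base point, `i₀` serves as the second line and x is where
          -- the two meet.
          refine ⟨i₀, fun h => ha (h ▸ hi₀), fun i hi => ?_⟩
          rw [← hO' i hi]
          exact tripleProduct_self_left _ _
      refine ⟨v a ⨯₃ v b, fun h => ?_, hb⟩
      obtain ⟨c, hc⟩ := exists_smul_of_cross_eq_zero hu h
      have h1 : v a ⬝ᵥ v a ⨯₃ v b = 0 := dot_self_cross _ _
      rw [hc, dotProduct_smul, hvu1 a ha, smul_eq_mul, mul_one] at h1
      rw [h1, zero_smul] at hc
      exact hcross a b hab hc
    · push Not at hO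
      obtain ⟨x, hx⟩ := exists_cross_ne_zero hu
      exact ⟨x, hx, fun i hi => absurd (hO i) hi⟩
  obtain ⟨y, hy⟩ : ∃ y : Fin 3 → ℂ, tripleProduct y u x ≠ 0 := by
    by_contra! h
    exact hx (dotProduct_eq_zero _ fun y => (dotProduct_comm _ _).trans (h y))
  have hdet : (Matrix.of ![u, x, y])ᵀ.det ≠ 0 := by
    rw [Matrix.det_transpose]
    rw [tripleProduct_rotate] at hy
    exact fun h => hy ((triple_product_eq_det u x y).trans h)
  -- The columns of the matrix are u, x, y, so the first two new coefficients are the values of the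
  -- form at u and x.
  refine ⟨Matrix.GeneralLinearGroup.mkOfDetNeZero _ hdet, fun i => rfl, fun i hi => hvx i hi⟩

/-- Three independent equations can be taken as coordinates. -/
theorem exists_coordinates_of_independent {v : Fin n → Fin 3 → ℂ} {a b c : Fin n}
    (h : tripleProduct (v a) (v b) (v c) ≠ 0) {u : Fin 3 → ℂ} (ha : v a ⬝ᵥ u = 1)
    (hb : v b ⬝ᵥ u = 1) (hc : v c ⬝ᵥ u = 1) :
    ∃ M : GL (Fin 3) ℂ, v a ᵥ* M.1 = Pi.single 0 1 ∧ v b ᵥ* M.1 = Pi.single 1 1 ∧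
      v c ᵥ* M.1 = Pi.single 2 1 ∧ ∀ i, (v i ᵥ* M.1) ⬝ᵥ 1 = v i ⬝ᵥ u := by
  have hdet : (Matrix.of ![v a, v b, v c]).det ≠ 0 :=
    fun h0 => h ((triple_product_eq_det _ _ _).trans h0)
  set N : GL (Fin 3) ℂ := Matrix.GeneralLinearGroup.mkOfDetNeZero _ hdet with hN
  have hNN : N.1 * (N⁻¹).1 = 1 := N.mul_inv
  have hNN' : (N⁻¹).1 * N.1 = 1 := N.inv_mul
  have hrow : ∀ k, (![v a, v b, v c] k) ᵥ* (N⁻¹).1 = Pi.single k 1 := by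
    intro k
    have : (![v a, v b, v c] k) = Pi.single k 1 ᵥ* N.1 := by
      rw [Matrix.single_one_vecMul]; rfl
    rw [this, Matrix.vecMul_vecMul, hNN, Matrix.vecMul_one]
  -- In the new coordinates the base point is (1, 1, 1), whichever realization is considered; this
  -- lets two realizations share one u.
  have hNu : N.1 *ᵥ u = 1 := by
    funext k
    fin_cases k
    exacts [ha, hb, hc]
  refine ⟨N⁻¹, hrow 0, hrow 1, hrow 2, fun i => ?_⟩
  rw [← hNu, Matrix.dotProduct_mulVec, Matrix.vecMul_vecMul, hNN', Matrix.vecMul_one]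

/-! ### Irreducibility of the moduli space -/

/-- If at most four lines of the arrangement `A` miss the point `p`, then the moduli space of `A` is
irreducible. -/
theorem irreducibleSpace_moduliSpace (A : LineTuple n) (hA : Function.Injective A) (p : Plane)
    (hp : 2 ≤ multiplicity A p) (hpn : n ≤ multiplicity A p + 4) :
    IrreducibleSpace (ModuliSpace A) := by
  classical
  obtain ⟨w, hw⟩ := exists_represents A
  set P : Fin n → Prop := fun i => p ∈ linePoints (A i) with hPdef
  have hPw : ∀ i, P i ↔ w i ⬝ᵥ p.rep = 0 := fun i => hw.mem_lineSubmodule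
  obtain ⟨i₀, hi₀, j₀, hj₀, hij⟩ := (Set.one_lt_ncard (s := {i | P i})).mp hp
  have hP : ∀ i, P i ↔ tripleProduct (w i) (w i₀) (w j₀) = 0 := by
    intro i
    obtain ⟨c, hc⟩ := (orthogonal_pair_iff (hw.cross_ne_zero hA hij)).mp
      ⟨(hPw i₀).mp hi₀, (hPw j₀).mp hj₀⟩
    have hc0 : c ≠ 0 := by
      rintro rfl
      exact p.rep_nonzero (by rw [hc, zero_smul])
    rw [hPw, hc, dotProduct_smul, smul_eq_mul, mul_eq_zero, or_iff_right hc0, tripleProduct]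
  have hO : (Finset.univ.filter fun i => ¬ P i).card ≤ 4 := by
    have h1 : multiplicity A p = (Finset.univ.filter P).card := by
      rw [← Set.ncard_coe_finset]
      simp [multiplicity, hPdef]
    have h2 := Finset.card_filter_add_card_filter_not (s := (Finset.univ : Finset (Fin n))) P
    rw [Finset.card_univ, Fintype.card_fin] at h2
    omega
  have normal : ∀ B C : LineTuple n, SameLattice B A → SameLattice C A →
      ∃ v v' : Fin n → Fin 3 → ℂ, Represents v B ∧ Represents v' C ∧ ∃ M M' : GL (Fin 3) ℂ,
        ∃ u m : Fin 3 → ℂ, u ≠ 0 ∧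
          (∀ i, P i → (v i ᵥ* M.1) ⬝ᵥ u = 0) ∧ (∀ i, ¬ P i → (v i ᵥ* M.1) ⬝ᵥ u = 1) ∧
          (∀ i, P i → (v' i ᵥ* M'.1) ⬝ᵥ u = 0) ∧ (∀ i, ¬ P i → (v' i ᵥ* M'.1) ⬝ᵥ u = 1) ∧
          ∀ i, ¬ P i → ∃ c : ℂ, v' i ᵥ* M'.1 - v i ᵥ* M.1 = c • m := by
    intro B C hB hC
    obtain ⟨v, hv, u, hu, hvu, hvu1⟩ := exists_normalized hA hw hB hij hP
    obtain ⟨v', hv', u', hu', hvu', hvu1'⟩ := exists_normalized hA hw hC hij hP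
    obtain ⟨hcross, hdep⟩ := (sameLattice_iff hv hw hA).mp hB
    obtain ⟨hcross', hdep'⟩ := (sameLattice_iff hv' hw hA).mp hC
    refine ⟨v, v', hv, hv', ?_⟩
    -- The case distinction depends on A alone, so both realizations receive the same kind of normal
    -- form.
    by_cases hconc : ∀ i j k, ¬ P i → ¬ P j → ¬ P k → tripleProduct (w i) (w j) (w k) = 0
    · obtain ⟨M, hM0, hM1⟩ := exists_coordinates_of_concurrent hu hcross hi₀ hvu1
        fun i j k hi hj hk => (hdep i j k).mpr (hconc i j k hi hj hk)
      obtain ⟨M', hM0', hM1'⟩ := exists_coordinates_of_concurrent hu' hcross' hi₀ hvu1'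
        fun i j k hi hj hk => (hdep' i j k).mpr (hconc i j k hi hj hk)
      refine ⟨M, M', Pi.single 0 1, Pi.single 2 1, by simp, ?_, ?_, ?_, ?_, ?_⟩
      · exact fun i hi => by rw [dotProduct_single_one, hM0, hvu i hi]
      · exact fun i hi => by rw [dotProduct_single_one, hM0, hvu1 i hi]
      · exact fun i hi => by rw [dotProduct_single_one, hM0', hvu' i hi]
      · exact fun i hi => by rw [dotProduct_single_one, hM0', hvu1' i hi]
      · intro i hi
        refine ⟨(v' i ᵥ* M'.1) 2 - (v i ᵥ* M.1) 2, funext fun j => ?_⟩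
        fin_cases j
        · simp [hM0, hM0', hvu1 i hi, hvu1' i hi]
        · simp [hM1 i hi, hM1' i hi]
        · simp
    · push Not at hconc
      obtain ⟨a, b, c, ha, hb, hc, habc⟩ := hconc
      obtain ⟨M, hMa, hMb, hMc, hMu⟩ := exists_coordinates_of_independent
        (mt (hdep a b c).mp habc) (hvu1 a ha) (hvu1 b hb) (hvu1 c hc)
      obtain ⟨M', hMa', hMb', hMc', hMu'⟩ := exists_coordinates_of_independent
        (mt (hdep' a b c).mp habc) (hvu1' a ha) (hvu1' b hb) (hvu1' c hc)
      have hab : a ≠ b := by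
        rintro rfl
        exact habc (tripleProduct_self_left _ _)
      have hbc : b ≠ c := by
        rintro rfl
        exact habc (tripleProduct_self_right _ _)
      have hac : a ≠ c := by
        rintro rfl
        rw [tripleProduct_rotate] at habc
        exact habc (tripleProduct_self_right _ _)
      -- Here the bound four is used: beyond a, b, c at most one line missing p remains. If there is
      -- none, d is an arbitrary index.
      obtain ⟨d, hd⟩ : ∃ d, ∀ i, ¬ P i → i = a ∨ i = b ∨ i = c ∨ i = d := by
        have hcard : ((Finset.univ.filter fun i => ¬ P i) \ {a, b, c}).card ≤ 1 := by
          rw [Finset.card_sdiff_of_subset, Finset.card_eq_three.mpr ⟨a, b, c, hab, hac, hbc, rfl⟩]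
          · omega
          · intro i hi
            simp only [Finset.mem_insert, Finset.mem_singleton] at hi
            rcases hi with rfl | rfl | rfl <;> simpa
        have : Nonempty (Fin n) := ⟨a⟩
        obtain ⟨d, hd⟩ := Finset.card_le_one_iff_subset_singleton.mp hcard
        refine ⟨d, fun i hi => ?_⟩
        by_contra! hne
        exact hne.2.2.2 (Finset.mem_singleton.mp (hd (by simp [hi, hne.1, hne.2.1, hne.2.2.1])))
      refine ⟨M, M', 1, v' d ᵥ* M'.1 - v d ᵥ* M.1, one_ne_zero, ?_, ?_, ?_, ?_, ?_⟩
      · exact fun i hi => by rw [hMu, hvu i hi]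
      · exact fun i hi => by rw [hMu, hvu1 i hi]
      · exact fun i hi => by rw [hMu', hvu' i hi]
      · exact fun i hi => by rw [hMu', hvu1' i hi]
      · intro i hi
        rcases hd i hi with rfl | rfl | rfl | rfl
        · exact ⟨0, by rw [hMa, hMa', sub_self, zero_smul]⟩
        · exact ⟨0, by rw [hMb, hMb', sub_self, zero_smul]⟩
        · exact ⟨0, by rw [hMc, hMc', sub_self, zero_smul]⟩
        · exact ⟨1, (one_smul _ _).symm⟩
  refine { isPreirreducible_univ := ?_, toNonempty := ⟨⟦⟨A, fun _ _ => rfl⟩⟧⟩ }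
  rintro U V hU hV ⟨x, -, hx⟩ ⟨y, -, hy⟩
  obtain ⟨⟨B, hB⟩, rfl⟩ := Quotient.exists_rep x
  obtain ⟨⟨C, hC⟩, rfl⟩ := Quotient.exists_rep y
  obtain ⟨U', hU', hUU'⟩ := isOpen_induced_iff.mp (hU.preimage continuous_quotient_mk')
  obtain ⟨V', hV', hVV'⟩ := isOpen_induced_iff.mp (hV.preimage continuous_quotient_mk')
  have memU : ∀ E : RealizationSpace A, E.1 ∈ U' ↔ (⟦E⟧ : ModuliSpace A) ∈ U := fun E =>
    Set.ext_iff.mp hUU' E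
  have memV : ∀ E : RealizationSpace A, E.1 ∈ V' ↔ (⟦E⟧ : ModuliSpace A) ∈ V := fun E =>
    Set.ext_iff.mp hVV' E
  obtain ⟨v, v', hv, hv', M, M', u, m, hu, h1, h2, h3, h4, h5⟩ := normal B C hB hC
  obtain ⟨B', hB', hrB, hBB'⟩ := exists_equivalent hA hB hv M
  obtain ⟨C', hC', hrC, hCC'⟩ := exists_equivalent hA hC hv' M'
  -- The trace of `U'` on the realization space is the preimage of `U`, hence stable under
  -- projective equivalence.
  have hB'U : B' ∈ U' := (memU ⟨B', hB'⟩).mpr ((Quotient.sound hBB' : (⟦_⟧ : ModuliSpace A) = _) ▸ hx)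
  have hC'V : C' ∈ V' := (memV ⟨C', hC'⟩).mpr ((Quotient.sound hCC' : (⟦_⟧ : ModuliSpace A) = _) ▸ hy)
  obtain ⟨f, hf0, hf1, hf⟩ := exists_curve hA hw hrB hrC hB' hC' P hu h1 h2 h3 h4 h5
  obtain ⟨D, hD, hDU, hDV⟩ := exists_mem_inter_of_curve hA hw f hB' hf0 hf1 hf hU' hV' hB'U hC'V
  exact ⟨⟦⟨D, hD⟩⟧, trivial, (memU ⟨D, hD⟩).mp hDU, (memV ⟨D, hD⟩).mp hDV⟩

end LineArrangement

end

theorem mainTheorem6 (A : LineArrangement.LineTuple 10) (hA : Function.Injective A)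
    (hmult : ∃ p : LineArrangement.Plane, 6 ≤ LineArrangement.multiplicity A p) :
    IrreducibleSpace (LineArrangement.ModuliSpace A) := by
  obtain ⟨p, hp⟩ := hmult
  -- With six of the ten lines through p, at most four miss it.
  exact LineArrangement.irreducibleSpace_moduliSpace A hA p (by omega) (by omega)
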